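/- A permutation of size $n=|\sigma|$ is a bijection $\sigma$ of $\{1,\dots,n\}$, written as the word $\sigma_1\sigma_2\cdots\sigma_n$ with $\sigma_i=\sigma(i)$. Write $\pi\preceq\sigma$ ($\pi$ is a pattern of $\sigma$) if there are $i_1<\dots<i_k$, $k=|\pi|$, such that $\pi$ is order-isomorphic to $\sigma_{i_1}\cdots\sigma_{i_k}$, and $\pi\prec\sigma$ if $\pi\preceq\sigma$ and $\pi\neq\sigma$. A permutation is simple if the only nonempty blocks of consecutive positions $i,i+1,\dots,j$ for which $\{\sigma_i,\dots,\sigma_j\}$ is a set of consecutive integers are the single positions and the whole of $\{1,\dots,n\}$. A permutation is exceptional if, for some $m\ge 2$, it is one of the following four permutations of size $2m$: (1) $2\ 4\ 6\cdots(2m)\ 1\ 3\ 5\cdots(2m-1)$; (2) $(2m-1)\ (2m-3)\cdots 1\ (2m)\ (2m-2)\cdots 2$; (3) $(m+1)\ 1\ (m+2)\ 2\cdots(2m)\ m$; (4) $m\ (2m)\ (m-1)\ (2m-1)\cdots 1\ (m+1)$. Theorem. Let $\sigma\neq\pi$ be two simple permutations with $\sigma$ not exceptional. If $\pi\prec\sigma$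 and $|\pi|\ge 3$, then there exists a simple permutation $\tau$ such that $\pi\preceq\tau\prec\sigma$ and $|\tau|=|\sigma|-1$. -/

import Mathlib

/-- A permutation of some finite size `n`. The entry `σ_j` of its word (`1 ≤ j ≤ n`) is
`toPerm ⟨j - 1, _⟩ + 1`: positions and values are shifted by one to live in `Fin n`. -/
structure FinPerm where
  size : ℕ
  toPerm : Equiv.Perm (Fin size)

namespace FinPerm

/-- `π` is a pattern of `σ`: `π` is order-isomorphic to a subsequence of `σ`. -/
def IsPattern (π σ : FinPerm) : Prop :=
  ∃ f : Fin π.size → Fin σ.size, StrictMono f ∧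
    ∀ a b : Fin π.size, π.toPerm a < π.toPerm b ↔ σ.toPerm (f a) < σ.toPerm (f b)

/-- Strict pattern containment. -/
def IsStrictPattern (π σ : FinPerm) : Prop :=
  π.IsPattern σ ∧ π ≠ σ

/-- The consecutive positions from `i` to `j` form an interval of `σ`: the set of their values
is an interval of integers. -/
def IsInterval (σ : FinPerm) (i j : Fin σ.size) : Prop :=
  i ≤ j ∧ ∃ a b : Fin σ.size, σ.toPerm '' Set.Icc i j = Set.Icc a b

/-- `σ` is simple: its only intervals are the singletons and the whole permutation. -/
def IsSimple (σ : FinPerm) : Prop :=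
  ∀ i j : Fin σ.size, σ.IsInterval i j → i = j ∨ Set.Icc i j = Set.univ

/-- `σ` is the word `w 1, w 2, …, w n`, with one-based positions and values. -/
def HasWord (σ : FinPerm) (w : ℕ → ℕ) : Prop :=
  ∀ i : Fin σ.size, (σ.toPerm i : ℕ) + 1 = w ((i : ℕ) + 1)

/-- `2 4 6 … (2m) 1 3 5 … (2m-1)`. -/
def exceptionalWord1 (m j : ℕ) : ℕ :=
  if j ≤ m then 2 * j else 2 * (j - m) - 1

/-- `(2m-1) (2m-3) … 1 (2m) (2m-2) … 2`. -/
def exceptionalWord2 (m j : ℕ) : ℕ :=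
  if j ≤ m then 2 * m + 1 - 2 * j else 2 * m + 2 - 2 * (j - m)

/-- `(m+1) 1 (m+2) 2 … (2m) m`. -/
def exceptionalWord3 (m j : ℕ) : ℕ :=
  if Odd j then m + (j + 1) / 2 else j / 2

/-- `m (2m) (m-1) (2m-1) … 1 (m+1)`. -/
def exceptionalWord4 (m j : ℕ) : ℕ :=
  if Odd j then m + 1 - (j + 1) / 2 else 2 * m + 1 - j / 2

/-- `σ` is exceptional: it has size `2m` with `m ≥ 2` and is of one of the four types. -/
def IsExceptional (σ : FinPerm) : Prop :=
  ∃ m : ℕ, 2 ≤ m ∧ σ.size = 2 * m ∧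
    (σ.HasWord (exceptionalWord1 m) ∨ σ.HasWord (exceptionalWord2 m) ∨
      σ.HasWord (exceptionalWord3 m) ∨ σ.HasWord (exceptionalWord4 m))

end FinPerm

/-!
The argument regards a permutation as the set of its points `(i, σ i)`. A module of a set of points
is a subset no two points of which are separated by a point of the set outside the subset; the
modules of the whole permutation are its intervals, so a permutation is simple exactly when its set
of points is prime, i.e. has only trivial modules.

Let `Y` be a maximal proper prime set of points of `σ` containing a copy of `π`. By a theorem of
Ehrenfeucht and Rozenberg (`PrimeOn.exists_extension`), a prime set with at least three points
inside a larger prime set can be enlarged by one or two points to a prime set. Hence `Y` misses one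
point, and then `Y` is the required permutation, or it misses exactly two.

In the second case, suppose that no single point can be deleted. Call `{a, b}` deletable if deleting
both points leaves a prime set with a copy of `π`. Deleting only `a` does not give a prime set, so
in `σ - a` the point `b` lies in a corner or has a twin `c`. If `c` is a twin, `{a, c}` is
deletable as well, since `b` can play the role of `c`; moreover `a` lies directly between `b` and
`c` in one coordinate, and `b`, `c` are adjacent in the other (`IsPairSystem.twins_cases`). Up to
exchanging the coordinates, `b, a, c` are at consecutive positions. Continuing with the pair
`{a, c}` gives the next position to the right, and so on up to the right end
(`IsPairSystem.run_right`); by reflection the same happens on the left. So any two points at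
distance two in position are adjacent in value, and the walks can stop only at a point that is
extremal but for the endmost one. These conditions leave only the exceptional permutations
(`shape`, `IsPairSystem.isExceptional`).
-/

namespace FinPerm

/-! ### Modules and prime sets of points -/

section Modules

variable {α β : Type*}

/-- Points are placed in the plane by a horizontal coordinate `x` and a vertical coordinate `y`.
`Same x y d a b` says that `d` does not separate `a` from `b`: both lie in the same quadrant as
seen from `d` (for `d ∉ {a, b}` and injective `x`, `y`). -/
def Same (x y : α → ℤ) (d a b : α) : Prop :=
  (x d < x a ↔ x d < x b) ∧ (y d < y a ↔ y d < y b)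

/-- `M` is a module of the set of points `W`: no point of `W` outside `M` separates two points
of `M`. For the points of a permutation these are the intervals. -/
def IsModule (x y : α → ℤ) (W M : Set α) : Prop :=
  M ⊆ W ∧ ∀ d ∈ W, d ∉ M → ∀ a ∈ M, ∀ b ∈ M, Same x y d a b

/-- `W` has no modules besides the empty set, the singletons and `W` itself. -/
def PrimeOn (x y : α → ℤ) (W : Set α) : Prop :=
  ∀ M, IsModule x y W M → M.Subsingleton ∨ M = W

variable {x y : α → ℤ}

lemma Same.refl (d a : α) : Same x y d a a := ⟨Iff.rfl, Iff.rfl⟩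

lemma Same.symm {d a b : α} (h : Same x y d a b) : Same x y d b a := ⟨h.1.symm, h.2.symm⟩

lemma Same.trans {d a b c : α} (h : Same x y d a b) (h' : Same x y d b c) : Same x y d a c :=
  ⟨h.1.trans h'.1, h.2.trans h'.2⟩

lemma Same.swap {d a b : α} (h : Same x y d a b) : Same y x d a b := ⟨h.2, h.1⟩

lemma Same.flip (hx : x.Injective) (hy : y.Injective) {d a b : α} (h : Same x y d a b)
    (ha : d ≠ a) (hb : d ≠ b) : (x a < x d ↔ x b < x d) ∧ (y a < y d ↔ y b < y d) := by
  have h1 := hx.ne ha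
  have h2 := hx.ne hb
  have h3 := hy.ne ha
  have h4 := hy.ne hb
  obtain ⟨h5, h6⟩ := h
  constructor <;> omega

lemma Same.neg (hx : x.Injective) {d a b : α} (h : Same x y d a b) (ha : d ≠ a) (hb : d ≠ b)
    (k : ℤ) : Same (fun p => k - x p) y d a b := by
  have h1 := hx.ne ha
  have h2 := hx.ne hb
  obtain ⟨h5, h6⟩ := h
  refine ⟨?_, h6⟩
  dsimp only
  omega

/-- If nothing is separated along three sides of a square of points, neither is it along the
fourth. -/
lemma Same.square (hx : x.Injective) (hy : y.Injective) {a b c d : α} (h₁ : Same x y a c d)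
    (h₂ : Same x y b c d) (h₃ : Same x y c a b) (hac : a ≠ c) (had : a ≠ d) (hbc : b ≠ c)
    (hbd : b ≠ d) : Same x y d a b := by
  have e1 := hx.ne hac
  have e2 := hx.ne had
  have e3 := hx.ne hbc
  have e4 := hx.ne hbd
  have f1 := hy.ne hac
  have f2 := hy.ne had
  have f3 := hy.ne hbc
  have f4 := hy.ne hbd
  obtain ⟨a1, a2⟩ := h₁
  obtain ⟨b1, b2⟩ := h₂
  obtain ⟨c1, c2⟩ := h₃
  constructor
  · clear a2 b2 c2 f1 f2 f3 f4
    omega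
  · clear a1 b1 c1 e1 e2 e3 e4
    omega

lemma IsModule.inter {W M X : Set α} (h : IsModule x y W M) (hX : X ⊆ W) :
    IsModule x y X (M ∩ X) :=
  ⟨Set.inter_subset_right, fun d hd hdM a ha b hb =>
    h.2 d (hX hd) (fun hdM' => hdM ⟨hdM', hd⟩) a ha.1 b hb.1⟩

lemma PrimeOn.subsingleton_inter_or_subset {W M X : Set α} (hX : PrimeOn x y X)
    (h : IsModule x y W M) (hXW : X ⊆ W) : (M ∩ X).Subsingleton ∨ X ⊆ M := by
  rcases hX _ (h.inter hXW) with h1 | h1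
  · exact .inl h1
  · exact .inr (h1 ▸ Set.inter_subset_left)

lemma PrimeOn.swap {W : Set α} (h : PrimeOn x y W) : PrimeOn y x W := fun M hM =>
  h M ⟨hM.1, fun d hd hdM a ha b hb => (hM.2 d hd hdM a ha b hb).swap⟩

/-- A map preserving both orders on `X` carries the prime set `X` to a prime set. -/
lemma PrimeOn.image {x' y' : β → ℤ} {X : Set β} (h : PrimeOn x' y' X) (s : β → α)
    (hxs : ∀ p ∈ X, ∀ q ∈ X, x' p < x' q ↔ x (s p) < x (s q))
    (hys : ∀ p ∈ X, ∀ q ∈ X, y' p < y' q ↔ y (s p) < y (s q)) : PrimeOn x y (s '' X) := by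
  intro M hM
  have hmod : IsModule x' y' X (s ⁻¹' M ∩ X) := by
    refine ⟨Set.inter_subset_right, fun d hd hdM a ha b hb => ?_⟩
    have := hM.2 (s d) ⟨d, hd, rfl⟩ (fun h' => hdM ⟨h', hd⟩) (s a) ha.1 (s b) hb.1
    refine ⟨?_, ?_⟩
    · rw [hxs d hd a ha.2, hxs d hd b hb.2]; exact this.1
    · rw [hys d hd a ha.2, hys d hd b hb.2]; exact this.2
  rcases h _ hmod with h1 | h1
  · left
    intro a ha b hb
    obtain ⟨p, hp, rfl⟩ := hM.1 ha
    obtain ⟨q, hq, rfl⟩ := hM.1 hb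
    rw [h1 ⟨ha, hp⟩ ⟨hb, hq⟩]
  · right
    refine hM.1.antisymm ?_
    rintro _ ⟨p, hp, rfl⟩
    exact (h1.symm ▸ hp : p ∈ s ⁻¹' M ∩ X).1

lemma PrimeOn.of_range {x' y' : β → ℤ} {e : β → α} (he : e.Injective)
    (h : PrimeOn x y (Set.range e)) (hxe : ∀ p q, x' p < x' q ↔ x (e p) < x (e q))
    (hye : ∀ p q, y' p < y' q ↔ y (e p) < y (e q)) : PrimeOn x' y' Set.univ := by
  intro M hM
  have hmod : IsModule x y (Set.range e) (e '' M) := by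
    refine ⟨Set.image_subset_range _ _, ?_⟩
    rintro _ ⟨d, rfl⟩ hd _ ⟨a, ha, rfl⟩ _ ⟨b, hb, rfl⟩
    have := hM.2 d (Set.mem_univ _) (fun hd' => hd ⟨d, hd', rfl⟩) a ha b hb
    rwa [Same, hxe, hxe, hye, hye] at this
  rcases h _ hmod with h' | h'
  · exact .inl fun a ha b hb => he (h' ⟨a, ha, rfl⟩ ⟨b, hb, rfl⟩)
  · right
    rwa [← Set.image_univ, he.image_injective.eq_iff] at h'

/-- How a one-point extension of a prime set can fail to be prime: the new point is a twin of an
old one, or it lies in a corner, where it separates no two old points. -/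
lemma PrimeOn.twin_or_corner {X : Set α} (hX : PrimeOn x y X) {b : α}
    (hnot : ¬ PrimeOn x y (insert b X)) :
    (∃ c ∈ X, ∀ w ∈ X, w ≠ c → Same x y w c b) ∨ ∀ w ∈ X, ∀ w' ∈ X, Same x y b w w' := by
  simp only [PrimeOn, not_forall, not_or] at hnot
  obtain ⟨M, hM, hns, hne⟩ := hnot
  rcases hX.subsingleton_inter_or_subset hM (Set.subset_insert b X) with h | h
  · left
    obtain ⟨p, hp, q, hq, hpq⟩ := Set.not_subsingleton_iff.mp hns
    obtain ⟨c, hcM, hcb⟩ : ∃ c ∈ M, c ≠ b := by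
      by_cases hpb : p = b
      · exact ⟨q, hq, fun h' => hpq (hpb.trans h'.symm)⟩
      · exact ⟨p, hp, hpb⟩
    have hmem : ∀ z ∈ M, z ≠ b → z ∈ X := fun z hz hzb =>
      (Set.mem_insert_iff.mp (hM.1 hz)).resolve_left hzb
    have hcX := hmem c hcM hcb
    have hbM : b ∈ M := by
      by_contra hbM
      have hz : ∀ z ∈ M, z ∈ M ∩ X := fun z hz => ⟨hz, hmem z hz fun h' => hbM (h' ▸ hz)⟩
      exact hpq (h (hz p hp) (hz q hq))
    refine ⟨c, hcX, fun w hw hwc => hM.2 w (Set.mem_insert_of_mem _ hw) (fun hwM => ?_) c hcM b hbM⟩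
    exact hwc (h ⟨hwM, hw⟩ ⟨hcM, hcX⟩)
  · right
    have hbM : b ∉ M := fun hbM => hne (hM.1.antisymm (Set.insert_subset hbM h))
    exact fun w hw w' hw' => hM.2 b (Set.mem_insert _ _) hbM w (h hw) w' (h hw')

/-- A prime set with at least three points inside a larger prime set can be enlarged to a prime
set by adding one point (`p = q`) or two. -/
theorem PrimeOn.exists_extension (hx : x.Injective) (hy : y.Injective) {X : Set α}
    (hX : PrimeOn x y X) (h3 : ∀ u v, ∃ w ∈ X, w ≠ u ∧ w ≠ v)
    (huniv : PrimeOn x y (Set.univ : Set α)) (hne : X ≠ Set.univ) :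
    ∃ p q, p ∉ X ∧ q ∉ X ∧ PrimeOn x y (insert p (insert q X)) := by
  by_contra! H
  have hXns : ¬ X.Subsingleton := fun h => by
    obtain ⟨z, -⟩ := (Set.ne_univ_iff_exists_notMem X).1 hne
    obtain ⟨u, hu, -⟩ := h3 z z
    obtain ⟨w, hw, hwu, -⟩ := h3 u u
    exact hwu (h hw hu)
  -- Some outside point is a twin of a point of `X`, since otherwise `X` would be a module.
  obtain ⟨u, hu, p₀, hp₀, hup₀⟩ : ∃ u ∈ X, ∃ p, p ∉ X ∧ ∀ w ∈ X, w ≠ u → Same x y w u p := by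
    by_contra! H'
    refine (huniv X ⟨Set.subset_univ _, fun d _ hd a ha b hb => ?_⟩).elim hXns hne
    have hd2 := H d d hd hd
    rw [Set.insert_idem] at hd2
    rcases hX.twin_or_corner hd2 with ⟨c, hc, h⟩ | h
    · obtain ⟨w, hw, hwc, hw'⟩ := H' c hc d hd
      exact absurd (h w hw hwc) hw'
    · exact h a ha b hb
  -- A point outside `X` is a twin of at most one point of `X`, and then not in a corner.
  have huniq : ∀ v ∈ X, ∀ p, p ∉ X → (∀ w ∈ X, w ≠ u → Same x y w u p) →
      (∀ w ∈ X, w ≠ v → Same x y w v p) → v = u := by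
    intro v hv p hp h1 h2
    by_contra hvu
    have hmod : IsModule x y X {u, v} := by
      refine ⟨by rintro z (rfl | rfl) <;> assumption, fun d hd hdM => ?_⟩
      have hdu : d ≠ u := fun h => hdM (.inl h)
      have hdv : d ≠ v := fun h => hdM (.inr h)
      have hs : Same x y d u v := (h1 d hd hdu).trans (h2 d hd hdv).symm
      rintro a (rfl | rfl) b (rfl | rfl)
      exacts [.refl _ _, hs, hs.symm, .refl _ _]
    rcases hX _ hmod with h | h
    · exact hvu (h (.inr rfl) (.inl rfl))
    · obtain ⟨w, hw, hwu, hwv⟩ := h3 u v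
      rw [← h] at hw
      exact hw.elim hwu hwv
  have hncorner : ∀ p, p ∉ X → (∀ w ∈ X, w ≠ u → Same x y w u p) →
      ¬ ∀ w ∈ X, ∀ w' ∈ X, Same x y p w w' := by
    intro p hp h1 h2
    have hmod : IsModule x y X (X \ {u}) := by
      refine ⟨Set.sdiff_subset, fun d hd hdM a ha b hb => ?_⟩
      obtain rfl : d = u := by
        by_contra h
        exact hdM ⟨hd, h⟩
      have hne' : ∀ w ∈ X, w ≠ p := fun w hw h => hp (h ▸ hw)
      exact Same.square hx hy (h1 a ha.1 ha.2).symm (h1 b hb.1 hb.2).symm (h2 a ha.1 b hb.1)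
        (hne' a ha.1) ha.2 (hne' b hb.1) hb.2
    rcases hX _ hmod with h | h
    · obtain ⟨w, hw, hwu, -⟩ := h3 u u
      obtain ⟨w', hw', hwu', hww'⟩ := h3 u w
      exact hww' (h ⟨hw', hwu'⟩ ⟨hw, hwu⟩)
    · rw [← h] at hu
      exact hu.2 rfl
  -- The point `u` together with all its outside twins is a nontrivial module.
  have hmod : IsModule x y Set.univ (insert u {p | p ∉ X ∧ ∀ w ∈ X, w ≠ u → Same x y w u p}) := by
    refine ⟨Set.subset_univ _, fun d _ hdN => ?_⟩
    have hdu : d ≠ u := fun h => hdN (.inl h)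
    suffices hs : ∀ p, p ∉ X → (∀ w ∈ X, w ≠ u → Same x y w u p) → Same x y d u p by
      rintro a (rfl | ha) b (rfl | hb)
      · exact .refl _ _
      · exact hs b hb.1 hb.2
      · exact (hs a ha.1 ha.2).symm
      · exact (hs a ha.1 ha.2).symm.trans (hs b hb.1 hb.2)
    intro p hp hup
    by_cases hdX : d ∈ X
    · exact hup d hdX hdu
    have hdtw : ¬ ∀ w ∈ X, w ≠ u → Same x y w u d := fun h => hdN (.inr ⟨hdX, h⟩)
    have hpd : p ≠ d := fun h => hdtw (h ▸ hup)
    have hnot := H p d hp hdX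
    simp only [PrimeOn, not_forall, not_or] at hnot
    obtain ⟨M, hM, hns, hneM⟩ := hnot
    have hXW : X ⊆ insert p (insert d X) :=
      (Set.subset_insert _ _).trans (Set.subset_insert _ _)
    have hpW : p ∈ insert p (insert d X) := .inl rfl
    have hdW : d ∈ insert p (insert d X) := .inr (.inl rfl)
    rcases hX.subsingleton_inter_or_subset hM hXW with h | h
    · by_cases hpM : p ∈ M
      · by_cases hMX : ∃ v ∈ M, v ∈ X
        · obtain ⟨v, hvM, hvX⟩ := hMX
          have hv : ∀ z ∈ M, ∀ w ∈ X, w ≠ v → Same x y w v z := fun z hz w hw hwv =>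
            hM.2 w (hXW hw) (fun hwM => hwv (h ⟨hwM, hw⟩ ⟨hvM, hvX⟩)) v hvM z hz
          obtain rfl := huniq v hvX p hp hup (hv p hpM)
          exact hM.2 d hdW (fun hdM => hdtw (hv d hdM)) v hvM p hpM
        · push Not at hMX
          have hdM : d ∈ M := by
            obtain ⟨r, hr, hrp⟩ := (Set.not_subsingleton_iff.mp hns).exists_ne p
            rcases hM.1 hr with h' | h' | h'
            · exact absurd h' hrp
            · exact h' ▸ hr
            · exact absurd h' (hMX r hr)
          exact absurd (fun w hw hwu => (hup w hw hwu).trans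
            (hM.2 w (hXW hw) (fun hwM => hMX w hwM hw) p hpM d hdM)) hdtw
      · have hMd : ∀ z ∈ M, z ≠ d → z ∈ X := fun z hz hzd => by
          rcases hM.1 hz with h' | h' | h'
          · exact absurd (h' ▸ hz) hpM
          · exact absurd h' hzd
          · exact h'
        obtain ⟨v, hvM, hvd⟩ := (Set.not_subsingleton_iff.mp hns).exists_ne d
        have hvX := hMd v hvM hvd
        have hdM : d ∈ M := by
          by_contra hdM
          obtain ⟨r, hr, hrv⟩ := (Set.not_subsingleton_iff.mp hns).exists_ne v
          exact hrv (h ⟨hr, hMd r hr fun h' => hdM (h' ▸ hr)⟩ ⟨hvM, hvX⟩)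
        have hvd' : ∀ w ∈ X, w ≠ v → Same x y w v d := fun w hw hwv =>
          hM.2 w (hXW hw) (fun hwM => hwv (h ⟨hwM, hw⟩ ⟨hvM, hvX⟩)) v hvM d hdM
        have hvu : v ≠ u := by
          rintro rfl
          exact hdtw hvd'
        have hpv : p ≠ v := fun h' => hp (h' ▸ hvX)
        exact Same.square hx hy (hvd' u hu hvu.symm) (hM.2 p hpW hpM v hvM d hdM)
          (hup v hvX hvu) hvu.symm hdu.symm hpv hpd
    · have hpM : p ∈ M := by
        by_contra hpM
        exact hncorner p hp hup fun w hw w' hw' => hM.2 p hpW hpM w (h hw) w' (h hw')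
      have hdM : d ∉ M := fun hdM =>
        hneM (hM.1.antisymm (Set.insert_subset hpM (Set.insert_subset hdM h)))
      exact hM.2 d hdW hdM u (h hu) p hpM
  rcases huniv _ hmod with h | h
  · exact hp₀ ((h (.inr ⟨hp₀, hup₀⟩) (.inl rfl) : p₀ = u) ▸ hu)
  · obtain ⟨w, hw, hwu, -⟩ := h3 u u
    rcases (h.symm ▸ Set.mem_univ w : w ∈ insert u {p | p ∉ X ∧ _}) with h' | h'
    · exact hwu h'
    · exact h'.1 hw

end Modules

/-! ### Walking through a permutation from which only pairs can be deleted -/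

section Walk

variable {α : Type*}

/-- `x` is a bijection onto the integers from `0` to `n - 1`. -/
structure IsCoordinate (x : α → ℤ) (n : ℤ) : Prop where
  inj : x.Injective
  nonneg : ∀ a, 0 ≤ x a
  lt : ∀ a, x a < n
  surj : ∀ k, 0 ≤ k → k < n → ∃ a, x a = k

lemma IsCoordinate.reverse {x : α → ℤ} {n : ℤ} (h : IsCoordinate x n) :
    IsCoordinate (fun p => n - 1 - x p) n where
  inj a b hab := h.inj (by dsimp only at hab; omega)
  nonneg a := by have := h.lt a; omega
  lt a := by have := h.nonneg a; omega
  surj k h0 hk := by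
    obtain ⟨a, ha⟩ := h.surj (n - 1 - k) (by omega) (by omega)
    exact ⟨a, by omega⟩

/-- `b` and `c` are twins once `a` is deleted: no point besides `a` separates them. -/
def Twins (x y : α → ℤ) (a b c : α) : Prop :=
  ∀ d, d ≠ a → d ≠ b → d ≠ c → Same x y d b c

/-- `b` lies in a corner once `a` is deleted. -/
def Corner (x y : α → ℤ) (a b : α) : Prop :=
  ∀ w w', w ≠ a → w ≠ b → w' ≠ a → w' ≠ b → Same x y b w w'

/-- The `n` points with coordinates `x`, `y` form a simple permutation, and `G` is a relation that
propagates along twins. In the application `G a b` says that deleting `a` and `b` leaves a simple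
permutation with the prescribed pattern, and that deleting `a` or `b` alone never does. -/
structure IsPairSystem (x y : α → ℤ) (n : ℤ) (G : α → α → Prop) : Prop where
  hx : IsCoordinate x n
  hy : IsCoordinate y n
  prime : PrimeOn x y (Set.univ : Set α)
  five_le : 5 ≤ n
  symm : ∀ a b, G a b → G b a
  ne : ∀ a b, G a b → a ≠ b
  step : ∀ a b, G a b → (∃ c, c ≠ a ∧ c ≠ b ∧ Twins x y a b c ∧ G a c) ∨ Corner x y a b

variable {x y : α → ℤ} {n : ℤ} {G : α → α → Prop}

lemma IsPairSystem.swap (h : IsPairSystem x y n G) : IsPairSystem y x n G where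
  hx := h.hy
  hy := h.hx
  prime := h.prime.swap
  five_le := h.five_le
  symm := h.symm
  ne := h.ne
  step a b hab := by
    rcases h.step a b hab with ⟨c, h1, h2, h3, h4⟩ | h1
    · exact .inl ⟨c, h1, h2, fun d e1 e2 e3 => (h3 d e1 e2 e3).swap, h4⟩
    · exact .inr fun w w' e1 e2 e3 e4 => (h1 w w' e1 e2 e3 e4).swap

lemma IsPairSystem.reverse (h : IsPairSystem x y n G) :
    IsPairSystem (fun p => n - 1 - x p) y n G where
  hx := h.hx.reverse
  hy := h.hy
  prime := by
    intro M hM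
    refine h.prime M ⟨hM.1, fun d hd hdM a ha b hb => ?_⟩
    have := (hM.2 d hd hdM a ha b hb).neg h.hx.reverse.inj (fun e => hdM (e ▸ ha))
      (fun e => hdM (e ▸ hb)) (n - 1)
    simpa using this
  five_le := h.five_le
  symm := h.symm
  ne := h.ne
  step a b hab := by
    rcases h.step a b hab with ⟨c, h1, h2, h3, h4⟩ | h1
    · exact .inl ⟨c, h1, h2, fun d e1 e2 e3 => (h3 d e1 e2 e3).neg h.hx.inj e2 e3 _, h4⟩
    · exact .inr fun w w' e1 e2 e3 e4 => (h1 w w' e1 e2 e3 e4).neg h.hx.inj e2.symm e4.symm _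

lemma IsPairSystem.exists_ne (h : IsPairSystem x y n G) (a b c : α) :
    ∃ d, d ≠ a ∧ d ≠ b ∧ d ≠ c := by
  have h5 := h.five_le
  obtain ⟨k, h0, hk, ha, hb, hc⟩ : ∃ k : ℤ, 0 ≤ k ∧ k < n ∧ k ≠ x a ∧ k ≠ x b ∧ k ≠ x c := by
    by_contra! H
    have h0 := H 0
    have h1 := H 1
    have h2 := H 2
    have h3 := H 3
    omega
  obtain ⟨d, rfl⟩ := h.hx.surj k h0 hk
  exact ⟨d, fun e => ha (e ▸ rfl), fun e => hb (e ▸ rfl), fun e => hc (e ▸ rfl)⟩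

/-- Two points cannot be adjacent in both coordinates. -/
lemma IsPairSystem.not_adjacent (h : IsPairSystem x y n G) {a b : α}
    (hxab : x b = x a + 1 ∨ x a = x b + 1) (hyab : y b = y a + 1 ∨ y a = y b + 1) : False := by
  have hmod : IsModule x y Set.univ {a, b} := by
    refine ⟨Set.subset_univ _, fun d _ hd => ?_⟩
    simp only [Set.mem_insert_iff, Set.mem_singleton_iff, not_or] at hd
    have e1 := h.hx.inj.ne hd.1
    have e2 := h.hx.inj.ne hd.2
    have e3 := h.hy.inj.ne hd.1
    have e4 := h.hy.inj.ne hd.2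
    have hs : Same x y d a b := ⟨by omega, by omega⟩
    rintro p (rfl | rfl) q (rfl | rfl)
    exacts [.refl _ _, hs, hs.symm, .refl _ _]
  rcases h.prime _ hmod with h' | h'
  · have : a = b := h' (.inl rfl) (.inr rfl)
    subst this
    omega
  · obtain ⟨d, h1, h2, -⟩ := h.exists_ne a b b
    exact (h' ▸ Set.mem_univ d : d ∈ ({a, b} : Set α)).elim h1 h2

/-- Three points cannot occupy three consecutive places in both coordinates. -/
lemma IsPairSystem.not_triple (h : IsPairSystem x y n G) {a b c : α} (hxab : x b = x a + 1)
    (hxbc : x c = x a + 2) {k : ℤ} (hya : k ≤ y a ∧ y a ≤ k + 2) (hyb : k ≤ y b ∧ y b ≤ k + 2)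
    (hyc : k ≤ y c ∧ y c ≤ k + 2) : False := by
  have hab : a ≠ b := by rintro rfl; omega
  have hac : a ≠ c := by rintro rfl; omega
  have hbc : b ≠ c := by rintro rfl; omega
  have f1 := h.hy.inj.ne hab
  have f2 := h.hy.inj.ne hac
  have f3 := h.hy.inj.ne hbc
  have hmod : IsModule x y Set.univ {a, b, c} := by
    refine ⟨Set.subset_univ _, fun d _ hd => ?_⟩
    simp only [Set.mem_insert_iff, Set.mem_singleton_iff, not_or] at hd
    have e1 := h.hx.inj.ne hd.1
    have e2 := h.hx.inj.ne hd.2.1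
    have e3 := h.hx.inj.ne hd.2.2
    have e4 := h.hy.inj.ne hd.1
    have e5 := h.hy.inj.ne hd.2.1
    have e6 := h.hy.inj.ne hd.2.2
    have hs : Same x y d a b := ⟨by omega, by omega⟩
    have ht : Same x y d a c := ⟨by omega, by omega⟩
    rintro p (rfl | rfl | rfl) q (rfl | rfl | rfl)
    exacts [.refl _ _, hs, ht, hs.symm, .refl _ _, hs.symm.trans ht, ht.symm, ht.symm.trans hs,
      .refl _ _]
  rcases h.prime _ hmod with h' | h'
  · exact hab (h' (.inl rfl) (.inr (.inl rfl)))
  · obtain ⟨d, h1, h2, h3⟩ := h.exists_ne a b c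
    exact (h' ▸ Set.mem_univ d : d ∈ ({a, b, c} : Set α)).elim h1 fun h'' => h''.elim h2 h3

/-- The points in between two points `b`, `c` separate them, so if only `a` may do so, `b` and `c`
are adjacent or have exactly `a` in between. -/
lemma IsCoordinate.gap (hx : IsCoordinate x n) {a b c : α} (hbc : b ≠ c)
    (h : ∀ d, d ≠ a → d ≠ b → d ≠ c → (x d < x b ↔ x d < x c)) :
    (x c = x b + 1 ∨ x b = x c + 1) ∨
      (x b + 1 = x a ∧ x a + 1 = x c ∨ x c + 1 = x a ∧ x a + 1 = x b) := by
  have hmid : ∀ k, (x b < k ∧ k < x c ∨ x c < k ∧ k < x b) → k = x a := by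
    intro k hk
    have h1 := hx.nonneg b
    have h2 := hx.nonneg c
    have h3 := hx.lt b
    have h4 := hx.lt c
    obtain ⟨d, rfl⟩ := hx.surj k (by omega) (by omega)
    by_contra hda
    have := h d (fun e => hda (e ▸ rfl)) (by rintro rfl; omega) (by rintro rfl; omega)
    omega
  have h0 := hx.inj.ne hbc
  have h1 := hmid (x b + 1)
  have h2 := hmid (x c - 1)
  have h3 := hmid (x b - 1)
  have h4 := hmid (x c + 1)
  omega

/-- Two points separated only by `a` have `a` directly in between in one coordinate and are
adjacent in the other. -/
lemma IsPairSystem.twins_cases (h : IsPairSystem x y n G) {a b c : α} (hbc : b ≠ c)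
    (ht : Twins x y a b c) :
    ((x b + 1 = x a ∧ x a + 1 = x c ∨ x c + 1 = x a ∧ x a + 1 = x b) ∧
        (y c = y b + 1 ∨ y b = y c + 1)) ∨
      ((y b + 1 = y a ∧ y a + 1 = y c ∨ y c + 1 = y a ∧ y a + 1 = y b) ∧
        (x c = x b + 1 ∨ x b = x c + 1)) := by
  rcases h.hx.gap hbc fun d h1 h2 h3 => (ht d h1 h2 h3).1 with h1 | h1 <;>
    rcases h.hy.gap hbc fun d h1 h2 h3 => (ht d h1 h2 h3).2 with h2 | h2
  · exact (h.not_adjacent h1 h2).elim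
  · exact .inr ⟨h2, h1⟩
  · exact .inl ⟨h1, h2⟩
  · exfalso
    rcases h1 with h1 | h1
    · exact h.not_triple (a := b) (b := a) (c := c) (k := min (y b) (y c)) (by omega) (by omega)
        (by omega) (by omega) (by omega)
    · exact h.not_triple (a := c) (b := a) (c := b) (k := min (y b) (y c)) (by omega) (by omega)
        (by omega) (by omega) (by omega)

/-- Two points cannot each lie in a corner once the other one is deleted. -/
lemma IsPairSystem.not_corner_corner (h : IsPairSystem x y n G) {a b : α} (hab : a ≠ b)
    (ha : Corner x y a b) (hb : Corner x y b a) : False := by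
  obtain ⟨w, hwa, hwb, -⟩ := h.exists_ne a b b
  have corner : ∀ {p q : α}, p ≠ q → Corner x y p q → w ≠ p → w ≠ q → ¬ Same x y q w p := by
    intro p q hpq hc hwp hwq hs
    have hq : ∀ v, v ≠ q → Same x y q w v := fun v hv => by
      by_cases hvp : v = p
      · exact hvp ▸ hs
      · exact hc w v hwp hwq hvp hv
    have hmod : IsModule x y Set.univ {q}ᶜ := by
      refine ⟨Set.subset_univ _, fun d _ hd u hu v hv => ?_⟩
      obtain rfl : d = q := by simpa using hd
      exact (hq u hu).symm.trans (hq v hv)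
    rcases h.prime _ hmod with h' | h'
    · exact hwp (h' hwq hpq)
    · exact (h'.symm ▸ Set.mem_univ q : q ∈ ({q}ᶜ : Set α)) rfl
  have h1 := corner hab ha hwa hwb
  have h2 := corner hab.symm hb hwb hwa
  have h3 : ¬ Same x y w a b := by
    intro hs
    have hmod : IsModule x y Set.univ {a, b} := by
      refine ⟨Set.subset_univ _, fun d _ hd => ?_⟩
      simp only [Set.mem_insert_iff, Set.mem_singleton_iff, not_or] at hd
      have hs' : Same x y d a b := Same.square h.hx.inj h.hy.inj (hb w d hwb hwa hd.2 hd.1)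
        (ha w d hwa hwb hd.1 hd.2) hs hwa.symm (Ne.symm hd.1) hwb.symm (Ne.symm hd.2)
      rintro p (rfl | rfl) q (rfl | rfl)
      exacts [.refl _ _, hs', hs'.symm, .refl _ _]
    rcases h.prime _ hmod with h' | h'
    · exact hab (h' (.inl rfl) (.inr rfl))
    · exact (h' ▸ Set.mem_univ w : w ∈ ({a, b} : Set α)).elim hwa hwb
  -- Each of `a`, `b`, `w` would be the middle one of the three in some coordinate.
  have e1 := h.hx.inj.ne hab
  have e2 := h.hx.inj.ne hwa
  have e3 := h.hx.inj.ne hwb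
  have f1 := h.hy.inj.ne hab
  have f2 := h.hy.inj.ne hwa
  have f3 := h.hy.inj.ne hwb
  unfold Same at h1 h2 h3
  omega

/-- Three horizontally consecutive points, the outer two of which are vertically adjacent. -/
def Run (x y : α → ℤ) (q₀ q₁ q₂ : α) : Prop :=
  x q₁ = x q₀ + 1 ∧ x q₂ = x q₁ + 1 ∧ (y q₂ = y q₀ + 1 ∨ y q₀ = y q₂ + 1)

/-- Among all points but `q`, the point `p` is the highest or the lowest. -/
def Extremal (y : α → ℤ) (p q : α) : Prop :=
  (∀ d, d ≠ q → y d ≤ y p) ∨ ∀ d, d ≠ q → y p ≤ y d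

lemma IsPairSystem.exists_run (h : IsPairSystem x y n G) {a b : α} (hab : G a b) :
    ∃ q₀ q₁ q₂, G q₀ q₁ ∧ G q₁ q₂ ∧ (Run x y q₀ q₁ q₂ ∨ Run y x q₀ q₁ q₂) := by
  obtain ⟨a, b, c, hbc, ht, h1, h2⟩ :
      ∃ a b c, c ≠ b ∧ Twins x y a b c ∧ G a b ∧ G a c := by
    rcases h.step a b hab with ⟨c, -, h2, h3, h4⟩ | h1
    · exact ⟨a, b, c, h2, h3, hab, h4⟩
    rcases h.step b a (h.symm a b hab) with ⟨c, -, h2, h3, h4⟩ | h2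
    · exact ⟨b, a, c, h2, h3, h.symm a b hab, h4⟩
    exact (h.not_corner_corner (h.ne a b hab) h1 h2).elim
  unfold Run
  rcases h.twins_cases hbc.symm ht with ⟨h3 | h3, h4⟩ | ⟨h3 | h3, h4⟩
  · exact ⟨b, a, c, h.symm a b h1, h2, .inl (by omega)⟩
  · exact ⟨c, a, b, h.symm a c h2, h1, .inl (by omega)⟩
  · exact ⟨b, a, c, h.symm a b h1, h2, .inr (by omega)⟩
  · exact ⟨c, a, b, h.symm a c h2, h1, .inr (by omega)⟩

/-- A run continues to the right by one point, or it has reached the right end. -/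
lemma IsPairSystem.run_step (h : IsPairSystem x y n G) {q₀ q₁ q₂ : α} (hr : Run x y q₀ q₁ q₂)
    (hG : G q₁ q₂) :
    (∃ q₃, Run x y q₁ q₂ q₃ ∧ G q₂ q₃) ∨ x q₂ = n - 1 ∧ Extremal y q₁ q₂ := by
  obtain ⟨h1, h2, h3⟩ := hr
  have hne02 : q₀ ≠ q₂ := by rintro rfl; omega
  have hne01 : q₀ ≠ q₁ := by rintro rfl; omega
  rcases h.step q₂ q₁ (h.symm _ _ hG) with ⟨c, hc2, hc1, ht, hGc⟩ | hc
  · left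
    have hx2 := h.hx.inj.ne hc2
    refine ⟨c, ?_, hGc⟩
    rcases h.twins_cases hc1.symm ht with ⟨h4, h5⟩ | ⟨h4, h5⟩
    · exact ⟨h2, by omega, h5⟩
    · -- Here `c = q₀`, and the three points `q₀`, `q₁`, `q₂` are consecutive in both coordinates.
      obtain rfl : c = q₀ := h.hx.inj (by omega)
      exact (h.not_triple (k := min (y c) (y q₁)) h1 (by omega : x q₂ = x c + 2) (by omega)
        (by omega) (by omega)).elim
  · right
    have hc' : ∀ d, d ≠ q₂ → d ≠ q₁ → Same x y q₁ q₀ d := fun d hd hd' =>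
      hc q₀ d hne02 hne01 hd hd'
    constructor
    · by_contra hlast
      have h4 := h.hx.lt q₂
      have h5 := h.hx.nonneg q₂
      obtain ⟨d, hd⟩ := h.hx.surj (x q₂ + 1) (by omega) (by omega)
      have := (hc' d (by rintro rfl; omega) (by rintro rfl; omega)).1
      omega
    · by_cases hlt : y q₁ < y q₀
      · right
        intro d hd
        by_cases hd' : d = q₁
        · rw [hd']
        · exact ((hc' d hd hd').2.1 hlt).le
      · left
        intro d hd
        by_cases hd' : d = q₁
        · rw [hd']
        · exact not_lt.1 fun h' => hlt ((hc' d hd hd').2.2 h')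

/-- A run continues to the right end. -/
lemma IsPairSystem.run_right (h : IsPairSystem x y n G) {q₀ q₁ q₂ : α} (hr : Run x y q₀ q₁ q₂)
    (hG : G q₁ q₂) :
    (∀ p q, x q₀ ≤ x p → x q = x p + 2 → y q = y p + 1 ∨ y p = y q + 1) ∧
      ∀ p q, x p = n - 2 → x q = n - 1 → Extremal y p q := by
  obtain ⟨k, hk⟩ : ∃ k : ℕ, n - x q₂ ≤ k := ⟨_, Int.self_le_toNat _⟩
  induction k generalizing q₀ q₁ q₂ with
  | zero =>
    have := h.hx.lt q₂
    omega
  | succ k ih =>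
    have hr' := hr
    obtain ⟨h1, h2, h3⟩ := hr'
    have hfirst : ∀ p q, x p = x q₀ → x q = x p + 2 → y q = y p + 1 ∨ y p = y q + 1 := by
      intro p q hp hq
      obtain rfl : p = q₀ := h.hx.inj hp
      obtain rfl : q = q₂ := h.hx.inj (by omega)
      exact h3
    rcases h.run_step hr hG with ⟨q₃, hr3, hG3⟩ | ⟨hend, hext⟩
    · obtain ⟨h4, h5⟩ := ih hr3 hG3 (by have := hr3.2.1; omega)
      refine ⟨fun p q hp hq => ?_, h5⟩
      by_cases hp' : x p = x q₀
      · exact hfirst p q hp' hq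
      · exact h4 p q (by omega) hq
    · refine ⟨fun p q hp hq => hfirst p q ?_ hq, fun p q hp hq => ?_⟩
      · have := h.hx.lt q
        omega
      · obtain rfl : p = q₁ := h.hx.inj (by omega)
        obtain rfl : q = q₂ := h.hx.inj (by omega)
        exact hext

/-- The columns of a pair system with a run: points two columns apart are vertically adjacent, and
the second column from either end is extremal. -/
lemma IsPairSystem.of_run (h : IsPairSystem x y n G) {q₀ q₁ q₂ : α} (hr : Run x y q₀ q₁ q₂)
    (hG : G q₀ q₁) (hG' : G q₁ q₂) :
    (∀ p q, x q = x p + 2 → y q = y p + 1 ∨ y p = y q + 1) ∧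
      (∀ p q, x p = n - 2 → x q = n - 1 → Extremal y p q) ∧
      ∀ p q, x p = 1 → x q = 0 → Extremal y p q := by
  obtain ⟨h1, h2⟩ := h.run_right hr hG'
  obtain ⟨e1, e2, e3⟩ := hr
  obtain ⟨h3, h4⟩ := h.reverse.run_right (q₀ := q₂) (q₁ := q₁) (q₂ := q₀)
    ⟨by dsimp only; omega, by dsimp only; omega, e3.symm⟩ (h.symm _ _ hG)
  refine ⟨fun p q hq => ?_, h2, fun p q hp hq => h4 p q (by omega)
    (by omega)⟩
  by_cases hp : x q₀ ≤ x p
  · exact h1 p q hp hq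
  · exact (h3 q p (by omega) (by omega)).symm

end Walk

/-! ### Identifying the exceptional permutations -/

section Shape

/-- An injective walk on the integers with steps `±1` never turns. -/
lemma walk_monotone {f : ℕ → ℤ} {K : ℕ} (hstep : ∀ j < K, f (j + 1) = f j + 1 ∨ f j = f (j + 1) + 1)
    (hne : ∀ j, j + 2 ≤ K → f (j + 2) ≠ f j) :
    (∀ j ≤ K, f j = f 0 + j) ∨ ∀ j ≤ K, f j = f 0 - j := by
  induction K with
  | zero =>
    left
    intro j hj
    obtain rfl : j = 0 := by omega
    simp
  | succ K ih =>
    have ih' := ih (fun j hj => hstep j (by omega)) (fun j hj => hne j (by omega))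
    have hlast := hstep K (by omega)
    rcases Nat.eq_zero_or_pos K with rfl | hK
    · rcases hlast with h | h
      · left; intro j hj
        rcases (by omega : j = 0 ∨ j = 1) with rfl | rfl <;> simp_all
      · right; intro j hj
        rcases (by omega : j = 0 ∨ j = 1) with rfl | rfl
        · simp
        · push_cast; simp only [zero_add] at h; omega
    · obtain ⟨L, rfl⟩ : ∃ L, K = L + 1 := ⟨K - 1, by omega⟩
      have hn := hne L (by omega)
      refine ih'.imp (fun h j hj => ?_) (fun h j hj => ?_) <;>
      · rcases (by omega : j ≤ L + 1 ∨ j = L + 1 + 1) with hj' | rfl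
        · exact h j hj'
        · have h1 := h L (by omega)
          have h2 := h (L + 1) le_rfl
          push_cast at h2 ⊢
          rw [show L + 1 + 1 = L + 2 from rfl] at *
          omega

variable {α : Type*} {x y : α → ℤ}

/-- The case of `shape` in which the second point from the left is the lowest one but for the first.
The points in odd and in even columns form two monotone walks. The odd one starts at the bottom and
ascends; the other extremal point, next to the right end, then has to be high. If it belonged to
the odd walk, the values of the third column would be trapped among those of the odd walk; so it
belongs to the even walk, which therefore ascends above the odd one. -/
lemma shape_of_low {n : ℕ} (hx : IsCoordinate x n) (hy : IsCoordinate y n) (h5 : 5 ≤ n)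
    (hrun : ∀ p q, x q = x p + 2 → y q = y p + 1 ∨ y p = y q + 1)
    (hR : ∀ p q, x p = n - 2 → x q = n - 1 → Extremal y p q)
    (hL : ∀ p q, x p = 1 → x q = 0 → ∀ d, d ≠ q → y p ≤ y d) :
    ∃ m : ℕ, n = 2 * m ∧ ∀ p, ∀ j : ℕ,
      (x p = 2 * j → y p = m + j) ∧ (x p = 2 * j + 1 → y p = j) := by
  have hP : ∀ i : ℕ, ∃ p, i < n → x p = i := by
    intro i
    by_cases hi : i < n
    · obtain ⟨p, hp⟩ := hx.surj i (by omega) (by omega)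
      exact ⟨p, fun _ => hp⟩
    · exact ⟨(hx.surj 0 le_rfl (by omega)).choose, fun h => absurd h hi⟩
  choose P hP using hP
  -- `w i` is the value in column `i`; only columns `i < n` matter.
  obtain ⟨w, hw⟩ : ∃ w : ℕ → ℤ, ∀ i, w i = y (P i) := ⟨_, fun _ => rfl⟩
  have hwx : ∀ p, ∀ i : ℕ, x p = i → y p = w i := fun p i hi => by
    have := hx.lt p
    rw [hw, hx.inj (hi.trans (hP i (by omega)).symm)]
  have hinj : ∀ i < n, ∀ j < n, w i = w j → i = j := fun i hi j hj hij => by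
    rw [hw, hw] at hij
    have := congrArg x (hy.inj hij)
    rw [hP i hi, hP j hj] at this
    exact_mod_cast this
  have h0 : ∀ i, 0 ≤ w i := fun i => hw i ▸ hy.nonneg _
  have hlt : ∀ i, w i < n := fun i => hw i ▸ hy.lt _
  have hne : ∀ i < n, ∀ j < n, i ≠ j → P i ≠ P j := fun i hi j hj hij h => by
    have := congrArg x h
    rw [hP i hi, hP j hj] at this
    omega
  have hstep : ∀ i, i + 2 < n → w (i + 2) = w i + 1 ∨ w i = w (i + 2) + 1 := fun i hi => by
    rw [hw, hw]
    exact hrun _ _ (by rw [hP i (by omega), hP _ hi]; push_cast; rfl)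
  have hlow : ∀ i < n, i ≠ 0 → w 1 ≤ w i := fun i hi hi0 => by
    rw [hw, hw]
    exact hL (P 1) (P 0) (by simpa using hP 1 (by omega)) (by simpa using hP 0 (by omega)) _
      (hne i hi 0 (by omega) hi0)
  have hend : (∀ i < n, i ≠ n - 1 → w i ≤ w (n - 2)) ∨ ∀ i < n, i ≠ n - 1 → w (n - 2) ≤ w i := by
    have := hR (P (n - 2)) (P (n - 1)) (by rw [hP _ (by omega)]; omega)
      (by rw [hP _ (by omega)]; omega)
    refine this.imp (fun h i hi hi' => ?_) (fun h i hi hi' => ?_) <;> rw [hw, hw] <;>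
      exact h _ (hne i hi _ (by omega) hi')
  have hodd : ∀ j, 2 * j + 1 < n → w (2 * j + 1) = w 1 + j := by
    rcases walk_monotone (f := fun j => w (2 * j + 1)) (K := (n - 2) / 2)
      (fun j hj => hstep (2 * j + 1) (by omega))
      (fun j hj e => absurd (hinj _ (by omega) _ (by omega) e) (by omega)) with h | h
    · exact fun j hj => h j (by omega)
    · have h1 := h 1 (by omega)
      have h2 := hlow 3 (by omega) (by omega)
      simp only [mul_one, mul_zero, zero_add] at h1
      norm_num at h1
      omega
  have heven := walk_monotone (f := fun j => w (2 * j)) (K := (n - 1) / 2)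
      (fun j hj => hstep (2 * j) (by omega))
      (fun j hj e => absurd (hinj _ (by omega) _ (by omega) e) (by omega))
  have hodd' : ∀ i < n, ∀ j, 2 * j + 1 < n → i ≠ 2 * j + 1 → w i ≠ w 1 + j :=
    fun i hi j hj hij e => hij (hinj i hi _ hj (e.trans (hodd j hj).symm))
  rcases Nat.even_or_odd' n with ⟨m, hm | hm⟩
  · refine ⟨m, hm, ?_⟩
    have hmax : ∀ i < n, i ≠ n - 1 → w i ≤ w (n - 2) := by
      refine hend.resolve_right fun h => ?_
      have h1 := h 1 (by omega) (by omega)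
      have h2 := hlow (n - 2) (by omega) (by omega)
      have := hinj _ (by omega) _ (by omega) (le_antisymm h1 h2)
      omega
    have hinc : ∀ j ≤ (n - 1) / 2, w (2 * j) = w 0 + j := by
      refine heven.resolve_right fun h => ?_
      have h1 := h (m - 1) (by omega)
      have h2 := hmax 0 (by omega) (by omega)
      rw [show n - 2 = 2 * (m - 1) by omega] at h2
      simp only [mul_zero] at h1
      omega
    have h2 : w 2 = w 0 + 1 := by simpa using hinc 1 (by omega)
    have h3 := hlow 2 (by omega) (by omega)
    have h4 := hodd' 0 (by omega) 0 (by omega) (by omega)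
    have h5' := hodd' 2 (by omega) 0 (by omega) (by omega)
    -- The even walk starts above the odd walk, whose values fill `w 1, …, w 1 + m - 1`.
    have h6 : w 1 + m ≤ w 0 := by
      by_contra hlt'
      have h7 := hodd' 0 (by omega) (w 0 - w 1).toNat (by omega) (by omega)
      omega
    have h7 := hinc (m - 1) (by omega)
    have h8 := hlt (2 * (m - 1))
    have h9 := h0 1
    have hw0 : w 0 = m := by omega
    have hw1 : w 1 = 0 := by omega
    intro p j
    have hpn := hx.lt p
    constructor
    · intro hp
      rw [hwx p (2 * j) (by push_cast; exact hp), hinc j (by omega), hw0]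
    · intro hp
      rw [hwx p (2 * j + 1) (by push_cast; exact hp), hodd j (by omega), hw1, zero_add]
  · exfalso
    have h1 := hodd (m - 1) (by omega)
    rw [show 2 * (m - 1) + 1 = n - 2 by omega] at h1
    rcases hend with h | h
    · have h2 := h 2 (by omega) (by omega)
      have h3 := hlow 2 (by omega) (by omega)
      have h4 := hodd' 2 (by omega) (w 2 - w 1).toNat (by omega) (by omega)
      omega
    · have := h 1 (by omega) (by omega)
      omega

/-- The shape of a pair system with a horizontal run: two interleaved monotone sequences, one
above the other. -/
lemma shape {n : ℕ} (hx : IsCoordinate x n) (hy : IsCoordinate y n) (h5 : 5 ≤ n)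
    (hrun : ∀ p q, x q = x p + 2 → y q = y p + 1 ∨ y p = y q + 1)
    (hR : ∀ p q, x p = n - 2 → x q = n - 1 → Extremal y p q)
    (hL : ∀ p q, x p = 1 → x q = 0 → Extremal y p q) :
    ∃ m : ℕ, n = 2 * m ∧
      ((∀ p, ∀ j : ℕ, (x p = 2 * j → y p = m + j) ∧ (x p = 2 * j + 1 → y p = j)) ∨
        ∀ p, ∀ j : ℕ, (x p = 2 * j → y p = m - 1 - j) ∧ (x p = 2 * j + 1 → y p = n - 1 - j)) := by
  obtain ⟨p, hp⟩ := hx.surj 1 (by omega) (by omega)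
  obtain ⟨q, hq⟩ := hx.surj 0 (by omega) (by omega)
  have huniq : ∀ p', x p' = 1 → p' = p := fun p' h => hx.inj (h.trans hp.symm)
  have huniq' : ∀ q', x q' = 0 → q' = q := fun q' h => hx.inj (h.trans hq.symm)
  rcases hL p q hp hq with h | h
  · obtain ⟨m, hm, H⟩ := shape_of_low (y := fun a => (n : ℤ) - 1 - y a) hx hy.reverse h5
      (fun a b hab => by have := hrun a b hab; omega)
      (fun a b ha hb => (hR a b ha hb).symm.imp (fun h d hd => by have := h d hd; dsimp only; omega)
        (fun h d hd => by have := h d hd; dsimp only; omega))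
      (fun a b ha hb d hd => by
        rw [huniq a ha]
        have := h d (huniq' b hb ▸ hd)
        omega)
    refine ⟨m, hm, .inr fun a j => ?_⟩
    have := H a j
    omega
  · obtain ⟨m, hm, H⟩ := shape_of_low hx hy h5 hrun hR (fun a b ha hb d hd => by
      rw [huniq a ha]
      exact h d (huniq' b hb ▸ hd))
    exact ⟨m, hm, .inl H⟩

end Shape

/-! ### Permutations as sets of points -/

section Bridge

/-- The horizontal coordinate of the points of a permutation. -/
def pos (σ : FinPerm) (i : Fin σ.size) : ℤ := (i : ℕ)

/-- The vertical coordinate of the points of a permutation. -/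
def val (σ : FinPerm) (i : Fin σ.size) : ℤ := (σ.toPerm i : ℕ)

variable {σ π : FinPerm}

lemma pos_lt_pos {i j : Fin σ.size} : σ.pos i < σ.pos j ↔ i < j := by
  simp [pos]

lemma val_lt_val {i j : Fin σ.size} : σ.val i < σ.val j ↔ σ.toPerm i < σ.toPerm j := by
  simp [val]

lemma isCoordinate_pos (σ : FinPerm) : IsCoordinate σ.pos σ.size where
  inj a b h := by simpa [pos, Fin.ext_iff] using h
  nonneg a := by simp [pos]
  lt a := by simp [pos]
  surj k h0 hk := ⟨⟨k.toNat, by omega⟩, by simp [pos, h0]⟩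

lemma isCoordinate_val (σ : FinPerm) : IsCoordinate σ.val σ.size where
  inj a b h := by simpa [val, Fin.val_inj] using h
  nonneg a := by simp [val]
  lt a := by simp [val]
  surj k h0 hk := ⟨σ.toPerm.symm ⟨k.toNat, by omega⟩, by simp [val, h0]⟩

lemma IsSimple.primeOn (h : σ.IsSimple) : PrimeOn σ.pos σ.val Set.univ := by
  intro M hM
  rcases M.eq_empty_or_nonempty with rfl | hne
  · exact .inl Set.subsingleton_empty
  obtain ⟨i, hi, hmin⟩ := M.exists_min_image id M.toFinite hne
  obtain ⟨j, hj, hmax⟩ := M.exists_max_image id M.toFinite hne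
  obtain ⟨a, ha, hamin⟩ := M.exists_min_image σ.toPerm M.toFinite hne
  obtain ⟨b, hb, hbmax⟩ := M.exists_max_image σ.toPerm M.toFinite hne
  dsimp only [id] at hmin hmax
  have hIcc : M = Set.Icc i j := by
    refine Set.Subset.antisymm (fun d hd => ⟨hmin d hd, hmax d hd⟩) fun d hd => ?_
    by_contra hdM
    have := (hM.2 d (Set.mem_univ _) hdM i hi j hj).1
    rw [pos_lt_pos, pos_lt_pos] at this
    have h1 : d ≠ i := fun e => hdM (e ▸ hi)
    have h2 : d ≠ j := fun e => hdM (e ▸ hj)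
    exact absurd (this.2 (lt_of_le_of_ne hd.2 h2)) (not_lt.2 hd.1)
  have himg : σ.toPerm '' Set.Icc i j = Set.Icc (σ.toPerm a) (σ.toPerm b) := by
    rw [← hIcc]
    refine Set.Subset.antisymm ?_ fun v hv => ?_
    · rintro _ ⟨d, hd, rfl⟩
      exact ⟨hamin d hd, hbmax d hd⟩
    · by_contra hvM
      obtain ⟨d, rfl⟩ := σ.toPerm.surjective v
      have hdM : d ∉ M := fun hd => hvM ⟨d, hd, rfl⟩
      have := (hM.2 d (Set.mem_univ _) hdM a ha b hb).2
      rw [val_lt_val, val_lt_val] at this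
      have h2 : σ.toPerm d ≠ σ.toPerm b := fun e => hdM (σ.toPerm.injective e ▸ hb)
      exact absurd (this.2 (lt_of_le_of_ne hv.2 h2)) (not_lt.2 hv.1)
  rcases h i j ⟨hmin j hj, _, _, himg⟩ with rfl | h'
  · left
    rw [hIcc, Set.Icc_self]
    exact Set.subsingleton_singleton
  · exact .inr (hIcc.trans h')

lemma isSimple_of_primeOn (h : PrimeOn σ.pos σ.val Set.univ) : σ.IsSimple := by
  rintro i j ⟨hij, a, b, hab⟩
  have hmem : ∀ d, d ∈ Set.Icc i j ↔ σ.toPerm d ∈ Set.Icc a b := fun d => by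
    rw [← hab, σ.toPerm.injective.mem_set_image]
  refine (h (Set.Icc i j) ⟨Set.subset_univ _, fun d _ hd u hu v hv => ⟨?_, ?_⟩⟩).imp_left
    fun h' => h' (Set.left_mem_Icc.2 hij) (Set.right_mem_Icc.2 hij)
  · rw [pos_lt_pos, pos_lt_pos]
    simp only [Set.mem_Icc] at hd hu hv
    omega
  · rw [val_lt_val, val_lt_val]
    rw [hmem] at hd hu hv
    simp only [Set.mem_Icc] at hd hu hv
    omega

/-- `g` places a copy of `π` on points of `σ`. -/
def IsEmb (π σ : FinPerm) (g : Fin π.size → Fin σ.size) : Prop :=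
  (∀ i j, π.pos i < π.pos j ↔ σ.pos (g i) < σ.pos (g j)) ∧
    ∀ i j, π.val i < π.val j ↔ σ.val (g i) < σ.val (g j)

lemma IsEmb.injective {g : Fin π.size → Fin σ.size} (h : IsEmb π σ g) : g.Injective := by
  intro i j hij
  have h1 := h.1 i j
  have h2 := h.1 j i
  rw [hij] at h1 h2
  exact π.isCoordinate_pos.inj (by omega)

lemma IsEmb.isPattern {g : Fin π.size → Fin σ.size} (h : IsEmb π σ g) : π.IsPattern σ :=
  ⟨g, fun i j hij => pos_lt_pos.1 ((h.1 i j).1 (pos_lt_pos.2 hij)),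
    fun i j => by rw [← val_lt_val, ← val_lt_val]; exact h.2 i j⟩

lemma IsPattern.exists_isEmb (h : π.IsPattern σ) : ∃ g, IsEmb π σ g := by
  obtain ⟨f, hf, hf'⟩ := h
  exact ⟨f, fun i j => by rw [pos_lt_pos, pos_lt_pos, hf.lt_iff_lt],
    fun i j => by rw [val_lt_val, val_lt_val]; exact hf' i j⟩

/-- The permutation formed by a set of points of `σ`. -/
lemma exists_restrict (σ : FinPerm) (W : Set (Fin σ.size)) :
    ∃ τ : FinPerm, τ.size = W.ncard ∧ ∃ e : Fin τ.size → Fin σ.size, IsEmb τ σ e ∧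
      Set.range e = W := by
  classical
  obtain ⟨F, rfl⟩ : ∃ F : Finset (Fin σ.size), W = F := ⟨W.toFinite.toFinset, by simp⟩
  have hcard : (F.map σ.toPerm.toEmbedding).card = F.card := F.card_map _
  let p := F.orderIsoOfFin rfl
  let q := (F.map σ.toPerm.toEmbedding).orderIsoOfFin hcard
  let s : F ≃ F.map σ.toPerm.toEmbedding :=
    σ.toPerm.subtypeEquiv fun a => by simp
  refine ⟨⟨F.card, p.toEquiv.trans (s.trans q.symm.toEquiv)⟩, by simp, fun i => (p i : Fin σ.size),
    ⟨fun i j => ?_, fun i j => ?_⟩, ?_⟩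
  · rw [pos_lt_pos, pos_lt_pos, Subtype.coe_lt_coe, p.lt_iff_lt]
  · rw [val_lt_val, val_lt_val]
    simp only [Equiv.trans_apply, OrderIso.coe_toEquiv, OrderIso.lt_iff_lt]
    rfl
  · ext a
    constructor
    · rintro ⟨i, rfl⟩
      exact (p i).2
    · intro ha
      exact ⟨p.symm ⟨a, ha⟩, by simp⟩

/-- A prime set of points of `σ` carries a simple permutation, and it contains `π` as soon as the
set contains a copy of `π`. -/
lemma PrimeOn.exists_isSimple {W : Set (Fin σ.size)} (hW : PrimeOn σ.pos σ.val W)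
    {g : Fin π.size → Fin σ.size} (hg : IsEmb π σ g) (hgW : ∀ i, g i ∈ W) :
    ∃ τ : FinPerm, τ.IsSimple ∧ π.IsPattern τ ∧ τ.IsPattern σ ∧ τ.size = W.ncard := by
  obtain ⟨τ, hsize, e, he, rfl⟩ := exists_restrict σ W
  refine ⟨τ, isSimple_of_primeOn ?_, ?_, he.isPattern, hsize⟩
  · exact hW.of_range he.injective he.1 he.2
  · choose t ht using hgW
    refine IsEmb.isPattern (g := t) ⟨fun i j => ?_, fun i j => ?_⟩
    · rw [he.1, ht, ht, hg.1]
    · rw [he.2, ht, ht, hg.2]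

end Bridge

/-! ### Deleting one point -/

/-- Twins can be interchanged: replacing `c` by `b` is an isomorphism of the points other than
`a`, `b` onto the points other than `a`, `c`. -/
lemma Twins.swap_lt_swap {α : Type*} [DecidableEq α] {x y : α → ℤ} (hx : x.Injective)
    (hy : y.Injective) {a b c : α} (ht : Twins x y a b c) {p q : α} (hpa : p ≠ a) (hpb : p ≠ b)
    (hqa : q ≠ a) (hqb : q ≠ b) :
    (x p < x q ↔ x (Equiv.swap b c p) < x (Equiv.swap b c q)) ∧
      (y p < y q ↔ y (Equiv.swap b c p) < y (Equiv.swap b c q)) := by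
  by_cases hpc : p = c <;> by_cases hqc : q = c
  · subst hpc hqc
    simp
  · subst hpc
    rw [Equiv.swap_apply_right, Equiv.swap_apply_of_ne_of_ne hqb hqc]
    have := (ht q hqa hqb hqc).flip hx hy hqb hqc
    exact ⟨this.1.symm, this.2.symm⟩
  · subst hqc
    rw [Equiv.swap_apply_right, Equiv.swap_apply_of_ne_of_ne hpb hpc]
    have := ht p hpa hpb hpc
    exact ⟨this.1.symm, this.2.symm⟩
  · rw [Equiv.swap_apply_of_ne_of_ne hqb hqc, Equiv.swap_apply_of_ne_of_ne hpb hpc]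
    exact ⟨Iff.rfl, Iff.rfl⟩

/-- `a` and `b` can be deleted together, leaving a simple permutation and a copy of `π`. -/
def DeletablePair (π σ : FinPerm) (a b : Fin σ.size) : Prop :=
  a ≠ b ∧ PrimeOn σ.pos σ.val {a, b}ᶜ ∧ ∃ g, IsEmb π σ g ∧ ∀ i, g i ≠ a ∧ g i ≠ b

variable {σ π : FinPerm}

lemma DeletablePair.symm {a b : Fin σ.size} (h : DeletablePair π σ a b) :
    DeletablePair π σ b a := by
  obtain ⟨h1, h2, g, h3, h4⟩ := h
  exact ⟨h1.symm, Set.pair_comm a b ▸ h2, g, h3, fun i => (h4 i).symm⟩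

lemma DeletablePair.of_twins {a b c : Fin σ.size} (h : DeletablePair π σ a b) (hca : c ≠ a)
    (ht : Twins σ.pos σ.val a b c) : DeletablePair π σ a c := by
  obtain ⟨hab, hprime, g, hg, hgab⟩ := h
  have hs := fun {p q : Fin σ.size} => ht.swap_lt_swap (p := p) (q := q)
    σ.isCoordinate_pos.inj σ.isCoordinate_val.inj
  have hmem : ∀ p ∈ ({a, b}ᶜ : Set (Fin σ.size)), p ≠ a ∧ p ≠ b := fun p hp => by
    simpa using hp
  refine ⟨hca.symm, ?_, fun i => Equiv.swap b c (g i), ⟨fun i j => ?_, fun i j => ?_⟩,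
    fun i => ⟨fun e => ?_, fun e => ?_⟩⟩
  · have := hprime.image (x := σ.pos) (y := σ.val) (Equiv.swap b c)
      (fun p hp q hq => (hs (hmem p hp).1 (hmem p hp).2 (hmem q hq).1 (hmem q hq).2).1)
      (fun p hp q hq => (hs (hmem p hp).1 (hmem p hp).2 (hmem q hq).1 (hmem q hq).2).2)
    rwa [Set.image_compl_eq (Equiv.swap b c).bijective, Set.image_pair, Equiv.swap_apply_left,
      Equiv.swap_apply_of_ne_of_ne hab hca.symm] at this
  · rw [hg.1, (hs (hgab i).1 (hgab i).2 (hgab j).1 (hgab j).2).1]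
  · rw [hg.2, (hs (hgab i).1 (hgab i).2 (hgab j).1 (hgab j).2).2]
  · rw [Equiv.swap_apply_eq_iff, Equiv.swap_apply_of_ne_of_ne hab hca.symm] at e
    exact (hgab i).1 e
  · rw [Equiv.swap_apply_eq_iff, Equiv.swap_apply_right] at e
    exact (hgab i).2 e

/-- If no single point can be deleted from `σ`, its deletable pairs propagate along twins. -/
lemma isPairSystem (hσ : σ.IsSimple) (h5 : 5 ≤ σ.size)
    (hno : ∀ a g, IsEmb π σ g → (∀ i, g i ≠ a) → ¬ PrimeOn σ.pos σ.val {a}ᶜ) :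
    IsPairSystem σ.pos σ.val σ.size (DeletablePair π σ) where
  hx := σ.isCoordinate_pos
  hy := σ.isCoordinate_val
  prime := hσ.primeOn
  five_le := by exact_mod_cast h5
  symm _ _ h := h.symm
  ne _ _ h := h.1
  step a b h := by
    obtain ⟨hab, hprime, g, hg, hgab⟩ := h
    have hins : insert b ({a, b}ᶜ : Set (Fin σ.size)) = {a}ᶜ := by
      ext p
      by_cases hp : p = b
      · simp [hp, hab.symm]
      · simp [hp]
    have hnot := hno a g hg fun i => (hgab i).1
    rw [← hins] at hnot
    rcases hprime.twin_or_corner hnot with ⟨c, hc, hct⟩ | hc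
    · simp only [Set.mem_compl_iff, Set.mem_insert_iff, Set.mem_singleton_iff, not_or] at hc hct
      have ht : Twins σ.pos σ.val a b c := fun d h1 h2 h3 => (hct d ⟨h1, h2⟩ h3).symm
      exact .inl ⟨c, hc.1, hc.2, ht,
        DeletablePair.of_twins ⟨hab, hprime, g, hg, hgab⟩ hc.1 ht⟩
    · exact .inr fun w w' h1 h2 h3 h4 => hc w (by simp [h1, h2]) w' (by simp [h3, h4])

/-- A horizontal run leads to `exceptionalWord3` or `exceptionalWord4`, a vertical one to the
inverse permutations, with words `exceptionalWord1` and `exceptionalWord2`. -/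
lemma IsPairSystem.isExceptional {G : Fin σ.size → Fin σ.size → Prop}
    (h : IsPairSystem σ.pos σ.val σ.size G) {a b : Fin σ.size} (hab : G a b) :
    σ.IsExceptional := by
  have h5 : 5 ≤ σ.size := by exact_mod_cast h.five_le
  obtain ⟨q₀, q₁, q₂, hG, hG', hr | hr⟩ := h.exists_run hab
  · obtain ⟨h1, h2, h3⟩ := h.of_run hr hG hG'
    obtain ⟨m, hm, H⟩ := shape h.hx h.hy h5 h1 h2 h3
    simp only [pos, val] at H
    refine ⟨m, by omega, hm, .inr (.inr (H.imp (fun H i => ?_) (fun H i => ?_)))⟩ <;>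
    · obtain ⟨j, hj | hj⟩ := Nat.even_or_odd' (i : ℕ)
      · have := (H i j).1 (by omega)
        have hodd : Odd ((i : ℕ) + 1) := ⟨j, by omega⟩
        simp only [exceptionalWord3, exceptionalWord4, if_pos hodd]
        omega
      · have := (H i j).2 (by omega)
        have hodd : ¬ Odd ((i : ℕ) + 1) := by
          rw [Nat.not_odd_iff_even]
          exact ⟨j + 1, by omega⟩
        simp only [exceptionalWord3, exceptionalWord4, if_neg hodd]
        omega
  · obtain ⟨h1, h2, h3⟩ := h.swap.of_run hr hG hG'
    obtain ⟨m, hm, H⟩ := shape h.hy h.hx h5 h1 h2 h3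
    simp only [pos, val] at H
    have hword : σ.HasWord (exceptionalWord1 m) ∨ σ.HasWord (exceptionalWord2 m) := by
      refine H.imp (fun H i => ?_) (fun H i => ?_) <;>
      · have hi := i.isLt
        have hv := (σ.toPerm i).isLt
        simp only [exceptionalWord1, exceptionalWord2]
        obtain ⟨j, hj | hj⟩ := Nat.even_or_odd' (σ.toPerm i : ℕ)
        · have := (H i j).1 (by omega)
          split_ifs <;> omega
        · have := (H i j).2 (by omega)
          split_ifs <;> omega
    exact ⟨m, by omega, hm, hword.elim .inl fun h => .inr (.inl h)⟩

/-- A strictly monotone self-map of `Fin n` is the identity, because `Fin n` has only one order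
automorphism; this is applied to the embedding of positions and then to the values. -/
lemma IsPattern.eq_of_size_eq (h : π.IsPattern σ) (hsize : π.size = σ.size) : π = σ := by
  obtain ⟨n, p⟩ := π
  obtain ⟨k, s⟩ := σ
  obtain ⟨f, hf, hfp⟩ := h
  dsimp only at hsize hf hfp
  subst hsize
  have hid : ∀ i, f i = i := fun i => by
    have := hf.id_le
    have hle : ∀ i, i ≤ f i := fun i => this i
    have := Subsingleton.elim (OrderIso.refl (Fin n)) (hf.orderIsoOfSurjective f
      (Finite.surjective_of_injective hf.injective))
    exact (congrArg (fun e : Fin n ≃o Fin n => e i) this).symm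
  have hmono : StrictMono (fun i => s (p.symm i)) := fun i j hij => by
    have := (hfp (p.symm i) (p.symm j)).1 (by simpa using hij)
    rwa [hid, hid] at this
  have := Subsingleton.elim (OrderIso.refl (Fin n)) (hmono.orderIsoOfSurjective _
    (Finite.surjective_of_injective hmono.injective))
  congr 1
  ext i
  have := congrArg (fun e : Fin n ≃o Fin n => e (p i)) this
  simpa [Fin.ext_iff] using this

end FinPerm

theorem mainTheorem2 (σ π : FinPerm) (hne : σ ≠ π) (hσ : σ.IsSimple) (hπ : π.IsSimple)
    (hexc : ¬ σ.IsExceptional) (hlt : π.IsStrictPattern σ) (hsize : 3 ≤ π.size) :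
    ∃ τ : FinPerm, τ.IsSimple ∧ π.IsPattern τ ∧ τ.IsStrictPattern σ ∧
      τ.size + 1 = σ.size := by
  obtain ⟨g₀, hg₀⟩ := hlt.1.exists_isEmb
  by_contra hτ
  -- No single point can be deleted so that a simple permutation containing `π` remains.
  have hno : ∀ a g, FinPerm.IsEmb π σ g → (∀ i, g i ≠ a) → ¬ FinPerm.PrimeOn σ.pos σ.val {a}ᶜ := by
    intro a g hg hga hprime
    obtain ⟨τ, h1, h2, h3, h4⟩ := hprime.exists_isSimple hg hga
    have hcard := Set.ncard_add_ncard_compl ({a} : Set (Fin σ.size))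
    rw [Set.ncard_singleton, Nat.card_fin, ← h4] at hcard
    refine hτ ⟨τ, h1, h2, ⟨h3, ?_⟩, by omega⟩
    rintro rfl
    omega
  -- Take a maximal proper prime set `Y` containing a copy of `π`.
  have hrange : FinPerm.PrimeOn σ.pos σ.val (Set.range g₀) := by
    rw [← Set.image_univ]
    exact hπ.primeOn.image g₀ (fun p _ q _ => hg₀.1 p q) fun p _ q _ => hg₀.2 p q
  have hproper : Set.range g₀ ≠ Set.univ := fun h => by
    have hbij : g₀.Bijective := ⟨hg₀.injective, Set.range_eq_univ.1 h⟩
    have := Nat.card_eq_of_bijective g₀ hbij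
    rw [Nat.card_fin, Nat.card_fin] at this
    exact hne (hlt.1.eq_of_size_eq this).symm
  obtain ⟨Y, hgY, ⟨hY, hYne⟩, hYmax⟩ :=
    (Set.toFinite {Y | FinPerm.PrimeOn σ.pos σ.val Y ∧ Y ≠ Set.univ}).exists_le_maximal
      ⟨hrange, hproper⟩
  have hgY' : ∀ i, g₀ i ∈ Y := fun i => hgY ⟨i, rfl⟩
  have h3 : ∀ u v, ∃ w ∈ Y, w ≠ u ∧ w ≠ v := by
    intro u v
    by_contra! H
    have e : ∀ i, g₀ i = u ∨ g₀ i = v := fun i => or_iff_not_imp_left.2 (H _ (hgY' i))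
    have inj : ∀ i j : Fin π.size, i ≠ j → g₀ i ≠ g₀ j := fun i j => hg₀.injective.ne
    have h01 := inj ⟨0, by omega⟩ ⟨1, by omega⟩ (by simp)
    have h02 := inj ⟨0, by omega⟩ ⟨2, by omega⟩ (by simp)
    have h12 := inj ⟨1, by omega⟩ ⟨2, by omega⟩ (by simp)
    have e0 := e ⟨0, by omega⟩
    have e1 := e ⟨1, by omega⟩
    have e2 := e ⟨2, by omega⟩
    grind
  obtain ⟨p, q, hp, hq, hpq⟩ := hY.exists_extension σ.isCoordinate_pos.inj
    σ.isCoordinate_val.inj h3 hσ.primeOn hYne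
  have huniv : insert p (insert q Y) = Set.univ := by
    by_contra h
    exact hp (hYmax ⟨hpq, h⟩ ((Set.subset_insert q Y).trans (Set.subset_insert p _)) (.inl rfl))
  have hYc : Y = {p, q}ᶜ := by
    ext z
    have hz : z = p ∨ z = q ∨ z ∈ Y :=
      (huniv ▸ Set.mem_univ z : z ∈ insert p (insert q Y))
    simp only [Set.mem_compl_iff, Set.mem_insert_iff, Set.mem_singleton_iff, not_or]
    refine ⟨fun h => ⟨fun e => hp (e ▸ h), fun e => hq (e ▸ h)⟩, fun h => ?_⟩
    exact (hz.resolve_left h.1).resolve_left h.2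
  have hg : ∀ i, g₀ i ≠ p ∧ g₀ i ≠ q := fun i =>
    ⟨fun e => hp (e ▸ hgY' i), fun e => hq (e ▸ hgY' i)⟩
  rw [hYc] at hY
  by_cases hpq' : p = q
  · subst hpq'
    rw [Set.pair_eq_singleton] at hY
    exact hno p g₀ hg₀ (fun i => (hg i).1) hY
  · have h5 : 5 ≤ σ.size := by
      have h1 := Set.ncard_add_ncard_compl ({p, q} : Set (Fin σ.size))
      rw [Set.ncard_pair hpq', Nat.card_fin, ← hYc] at h1
      have h2 := Set.ncard_le_ncard hgY
      rw [← Set.image_univ, Set.ncard_image_of_injective _ hg₀.injective, Set.ncard_univ,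
        Nat.card_fin] at h2
      omega
    exact hexc ((FinPerm.isPairSystem hσ h5 hno).isExceptional
      (⟨hpq', hY, g₀, hg₀, hg⟩ : FinPerm.DeletablePair π σ p q))
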